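/- Let $K$ be a field with $|K|=2$, let $V$ be a finite-dimensional vector space over $K$, and let $f:V\to V$ be a nilpotent $K$-linear map. A subspace $X\subseteq V$ is called *hyperinvariant* if it is invariant under all endomorphisms of $V$ that commute with $f$, and *characteristic* if it is $f$-invariant and invariant under all automorphisms of $V$ that commute with $f$; let $\mathrm{Aut}(V,f)$ denote the group of these automorphisms. For $x\in V$ let $\langle x\rangle=\mathrm{span}\{f^ix : i\ge 0\}$, and let the exponent $\mathrm{e}(x)$ be the smallest integer $\ell\ge 0$ with $f^\ell x=0$. For $B\subseteq V$ let $\langle B\rangle=\sum_{b\in B}\langle b\rangle$, and let $B^c=\langle \alpha b : b\in B,\ \alpha\in\mathrm{Aut}(V,f)\rangle$ be the characteristic hull of $B$. A nonzero vector $u\in V$ is a *generator* of $V$ if $V=\langle u\rangle\oplus V_2$ for some $f$-invariant subspace $V_2$. An elementary divisor $\lambda^r$ of $f$ is *unrepeated* if it occurs exactly once among the elementary divisors of $f$. Suppose $\lambda^R$ and $\lambda^S$ are unrepeated elementary divisors of $f$ with $R+1<S$, and let $u,v$ be generators of $V$ with $\mathrm{e}(u)=R$ and $\mathrm{e}(v)=S$.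 (i) If the integers $s,q$ satisfy $$0<s\le R,\qquad s<q,\qquad R-s<S-q, \tag{1}$$ then the subspace $$X=\langle f^{R-s}u+f^{S-q}v\rangle^c \tag{2}$$ is characteristic and not hyperinvariant. (ii) Suppose $V=\langle u\rangle\oplus\langle v\rangle$. Then an $f$-invariant subspace $X\subseteq V$ is characteristic and not hyperinvariant if and only if $X$ is of the form (2) for some integers $s,q$ satisfying (1). -/

import Mathlib

open Polynomial

namespace CharSub

variable {K V : Type*} [Field K] [AddCommGroup V] [Module K V]

/-- `X` is hyperinvariant under `f`: it is invariant under every endomorphism commuting with `f`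
(in particular under `f` itself). -/
def IsHyperinvariant (f : Module.End K V) (X : Submodule K V) : Prop :=
  ∀ g : Module.End K V, Commute g f → ∀ x ∈ X, g x ∈ X

/-- The automorphisms of `V` that commute with `f`. -/
def Aut (f : Module.End K V) : Set (V ≃ₗ[K] V) :=
  {α | ∀ x, α (f x) = f (α x)}

/-- `X` is characteristic with respect to `f`: it is `f`-invariant, and invariant under every
automorphism of `V` commuting with `f`. -/
def IsCharacteristic (f : Module.End K V) (X : Submodule K V) : Prop :=
  (∀ x ∈ X, f x ∈ X) ∧ ∀ α ∈ Aut f, ∀ x ∈ X, α x ∈ X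

/-- The `f`-cyclic subspace `⟨x⟩ = span {fⁱ x ; i ≥ 0}`. -/
def cyclic (f : Module.End K V) (x : V) : Submodule K V :=
  Submodule.span K (Set.range fun i : ℕ => (f ^ i) x)

/-- `⟨B⟩ = ∑_{b ∈ B} ⟨b⟩`. -/
def generated (f : Module.End K V) (B : Set V) : Submodule K V :=
  ⨆ b ∈ B, cyclic f b

/-- The characteristic hull `Bᶜ = ⟨α b ; b ∈ B, α ∈ Aut(V, f)⟩`. -/
def charHull (f : Module.End K V) (B : Set V) : Submodule K V :=
  generated f {y | ∃ b ∈ B, ∃ α ∈ Aut f, y = α b}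

/-- The exponent of `x`: the smallest `ℓ ≥ 0` with `f^ℓ x = 0` (it exists if `f` is nilpotent). -/
noncomputable def exponent (f : Module.End K V) (x : V) : ℕ :=
  sInf {l : ℕ | (f ^ l) x = 0}

/-- `u` is a generator of `V` with respect to `f`: `u ≠ 0` and `V = ⟨u⟩ ⊕ V₂` for some
`f`-invariant subspace `V₂`. -/
def IsGenerator (f : Module.End K V) (u : V) : Prop :=
  u ≠ 0 ∧ ∃ V₂ : Submodule K V, (∀ x ∈ V₂, f x ∈ V₂) ∧ IsCompl (cyclic f u) V₂

/-- `d` lists the elementary divisors of `f` (with repetitions): the `d i` are powers, with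
positive exponents, of monic irreducible polynomials, and `V`, as the `K[X]`-module on which `X`
acts as `f`, is isomorphic to the direct sum of the cyclic modules `K[X] / (d i)`. -/
def HasElementaryDivisors (f : Module.End K V) {m : ℕ} (d : Fin m → K[X]) : Prop :=
  (∀ i, ∃ (p : K[X]) (k : ℕ), p.Monic ∧ Irreducible p ∧ 0 < k ∧ d i = p ^ k) ∧
    Nonempty (Module.AEval' f ≃ₗ[K[X]] ((i : Fin m) → K[X] ⧸ Ideal.span {d i}))

/-- `X ^ r` is an unrepeated elementary divisor of `f`: it occurs exactly once among the
elementary divisors of `f`. -/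
def IsUnrepeated (f : Module.End K V) (r : ℕ) : Prop :=
  ∃ (m : ℕ) (d : Fin m → K[X]), HasElementaryDivisors f d ∧ ∃! i, d i = X ^ r

end CharSub

namespace CharSub

variable {K V : Type*} [Field K] [AddCommGroup V] [Module K V]

/-! ### Cyclic subspaces as modules over the local ring `K[f]`. -/

section Cyclic

variable {f : Module.End K V}

/-! Put a = R - s and b = S - q, so that (1) reads a < R, a < b and b - a < S - R. An automorphism
commuting with f acts by a nonzero scalar on the Ulm quotient ker f^r / (ker f^(r-1) + f ker
f^(r+1)), which is one-dimensional when λ^r is unrepeated; over two elements that scalar is 1. So u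
and v are fixed up to higher powers of f on their own components (`exists_projection_aut_eq`), and
the inequalities push the cross terms beyond f^a u and f^b v. All vectors of the hull thus have
equal leading coefficients (`linkedLeading`), while a projection would separate f^a u from f^b v
(`not_isHyperinvariant_charHull`).

Conversely, if E is nilpotent and commutes with f, then 1 + E is an automorphism, so a
characteristic X is stable under E (`IsCharacteristic.map_mem_of_isNilpotent`). For V = ⟨u⟩ ⊕ ⟨v⟩
this covers f times each projection and the two maps exchanging the summands; hyperinvariance can
fail only through the projections themselves. Such a failure singles out f^a u and f^b v outside X
whose sum lies in X and generates it as a hull (`BicyclicMaps.exists_eq_charHull`). -/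

lemma commute_aeval {g : Module.End K V} (hg : Commute g f) (p : K[X]) (x : V) :
    g (aeval f p x) = aeval f p (g x) := by
  have h : Commute g (aeval f p) := by
    induction p using Polynomial.induction_on' with
    | add p q hp hq => rw [map_add]; exact hp.add_right hq
    | monomial n a =>
      rw [aeval_monomial]
      exact Commute.mul_right (Algebra.commutes a g).symm (hg.pow_right n)
  exact LinearMap.congr_fun h.eq x

lemma aeval_mul_apply (p q : K[X]) (x : V) : aeval f (p * q) x = aeval f p (aeval f q x) := by
  rw [map_mul, Module.End.mul_apply]

lemma aeval_X_pow_apply (n : ℕ) (x : V) : aeval f (X ^ n : K[X]) x = (f ^ n) x := by simp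

lemma aeval_mem {Y : Submodule K V} (hY : ∀ x ∈ Y, f x ∈ Y) (p : K[X]) {x : V} (hx : x ∈ Y) :
    aeval f p x ∈ Y := by
  induction p using Polynomial.induction_on' with
  | add p q hp hq => rw [map_add]; exact Y.add_mem hp hq
  | monomial n a =>
    have h : (f ^ n) x ∈ Y := by
      induction n with
      | zero => simpa using hx
      | succ n ih => rw [pow_succ', Module.End.mul_apply]; exact hY _ ih
    simpa [aeval_monomial] using Y.smul_mem a h

lemma mem_cyclic_iff {x y : V} : y ∈ cyclic f x ↔ ∃ p : K[X], y = aeval f p x := by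
  constructor
  · intro h
    induction h using Submodule.span_induction with
    | mem _ h => obtain ⟨i, rfl⟩ := h; exact ⟨X ^ i, by simp⟩
    | zero => exact ⟨0, by simp⟩
    | add _ _ _ _ h₁ h₂ =>
      obtain ⟨p, rfl⟩ := h₁
      obtain ⟨q, rfl⟩ := h₂
      exact ⟨p + q, by simp⟩
    | smul a _ _ h =>
      obtain ⟨p, rfl⟩ := h
      exact ⟨a • p, by simp⟩
  · rintro ⟨p, rfl⟩
    rw [aeval_eq_sum_range, LinearMap.sum_apply]
    refine Submodule.sum_mem _ fun i _ => ?_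
    exact Submodule.smul_mem _ _ (Submodule.subset_span ⟨i, rfl⟩)

lemma self_mem_cyclic (x : V) : x ∈ cyclic f x := mem_cyclic_iff.2 ⟨1, by simp⟩

lemma map_mem_cyclic (x : V) : ∀ y ∈ cyclic f x, f y ∈ cyclic f x := by
  intro y hy
  obtain ⟨p, rfl⟩ := mem_cyclic_iff.1 hy
  exact mem_cyclic_iff.2 ⟨X * p, by simp⟩

lemma cyclic_le {Y : Submodule K V} (hY : ∀ x ∈ Y, f x ∈ Y) {x : V} (hx : x ∈ Y) :
    cyclic f x ≤ Y := by
  intro y hy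
  obtain ⟨p, rfl⟩ := mem_cyclic_iff.1 hy
  exact aeval_mem hY p hx

lemma pow_mem_of_le {Y : Submodule K V} (hY : ∀ x ∈ Y, f x ∈ Y) {x : V} {m n : ℕ} (hmn : m ≤ n)
    (hx : (f ^ m) x ∈ Y) : (f ^ n) x ∈ Y := by
  obtain ⟨k, rfl⟩ := Nat.exists_eq_add_of_le' hmn
  rw [pow_add, Module.End.mul_apply, ← aeval_X_pow_apply k]
  exact aeval_mem hY _ hx

lemma pow_exponent_apply (hf : IsNilpotent f) (x : V) : (f ^ exponent f x) x = 0 := by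
  obtain ⟨n, hn⟩ := hf
  exact Nat.sInf_mem (s := {l : ℕ | (f ^ l) x = 0}) ⟨n, by simp [hn]⟩

lemma exponent_le {x : V} {n : ℕ} (h : (f ^ n) x = 0) : exponent f x ≤ n := Nat.sInf_le h

lemma exists_eq_X_pow_mul {p : K[X]} (hp : p ≠ 0) :
    ∃ (k : ℕ) (q : K[X]), p = X ^ k * q ∧ q.coeff 0 ≠ 0 := by
  obtain ⟨q, hq, hdvd⟩ := Polynomial.exists_eq_pow_rootMultiplicity_mul_and_not_dvd p hp 0
  simp only [map_zero, sub_zero] at hq hdvd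
  exact ⟨_, q, hq, fun h => hdvd (X_dvd_iff.2 h)⟩

lemma exists_mul_add_X_pow {q : K[X]} (hq : q.coeff 0 ≠ 0) (n : ℕ) :
    ∃ a b : K[X], a * q + b * X ^ n = 1 := by
  have : IsCoprime X q := irreducible_X.coprime_iff_not_dvd.2
    fun h => hq (X_dvd_iff.1 h)
  exact this.symm.pow_right

/-- A polynomial in `f` with nonzero constant term is invertible on `V`. -/
lemma exists_aeval_inv (hf : IsNilpotent f) {q : K[X]} (hq : q.coeff 0 ≠ 0) :
    ∃ a : K[X], ∀ x, aeval f a (aeval f q x) = x := by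
  obtain ⟨n, hn⟩ := hf
  obtain ⟨a, b, h⟩ := exists_mul_add_X_pow hq n
  refine ⟨a, fun x => ?_⟩
  have := congrArg (fun p => aeval f p x) h
  simpa [hn] using this

lemma aeval_apply_eq_zero_iff (hf : IsNilpotent f) {x : V} {p : K[X]} :
    aeval f p x = 0 ↔ X ^ exponent f x ∣ p := by
  constructor
  · intro h
    rcases eq_or_ne p 0 with rfl | hp
    · simp
    obtain ⟨k, q, rfl, hq⟩ := exists_eq_X_pow_mul hp
    obtain ⟨a, ha⟩ := exists_aeval_inv hf hq
    rw [mul_comm, aeval_mul_apply, aeval_X_pow_apply] at h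
    have h' : (f ^ k) x = 0 := by rw [← ha ((f ^ k) x), h, map_zero]
    exact (pow_dvd_pow X (exponent_le h')).mul_right q
  · rintro ⟨q, rfl⟩
    rw [mul_comm, aeval_mul_apply, aeval_X_pow_apply, pow_exponent_apply hf, map_zero]

/-- The factor c - X r has nonzero constant term, hence is invertible in `K[f]`: a vector equal to a
term of higher order vanishes. -/
lemma le_of_smul_pow_apply_eq (hf : IsNilpotent f) {x : V} {k : ℕ} {c : K} {r : K[X]} (hc : c ≠ 0)
    (h : c • (f ^ k) x = aeval f (X ^ (k + 1) * r) x) : exponent f x ≤ k := by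
  have h0 : aeval f (X ^ k * (C c - X * r)) x = 0 := by
    have : (X ^ k * (C c - X * r) : K[X]) = c • X ^ k - X ^ (k + 1) * r := by
      rw [smul_eq_C_mul]; ring
    rw [this, map_sub, LinearMap.sub_apply, ← h]
    simp
  obtain ⟨a, ha⟩ := exists_aeval_inv hf (q := C c - X * r) (by simpa using hc)
  rw [mul_comm, aeval_mul_apply, aeval_X_pow_apply] at h0
  exact exponent_le (by rw [← ha ((f ^ k) x), h0, map_zero])

lemma exists_eq_C_add_X_mul (p : K[X]) : ∃ r : K[X], p = C (p.coeff 0) + X * r :=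
  ⟨p.divX, by rw [add_comm]; exact (X_mul_divX_add p).symm⟩

/-- The commuting map on a cyclic subspace that sends the generator to a given vector,
precomposed with a projection onto that subspace. -/
lemma exists_commute_apply_eq (hf : IsNilpotent f) {P : Module.End K V} (hP : Commute P f) {x y : V}
    (hPx : P x = x) (hPc : ∀ w, P w ∈ cyclic f x) (hy : (f ^ exponent f x) y = 0) :
    ∃ g : Module.End K V, Commute g f ∧ g x = y ∧ ∀ w, P w = 0 → g w = 0 := by
  let T (z : V) : K[X] →ₗ[K] V := (LinearMap.applyₗ (R := K) z).comp (aeval (R := K) f).toLinearMap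
  have hT : ∀ z (p : K[X]), T z p = aeval f p z := fun _ _ => rfl
  have hker : LinearMap.ker (T x) ≤ LinearMap.ker (T y) := by
    intro p hp
    rw [LinearMap.mem_ker, hT] at hp ⊢
    obtain ⟨q, rfl⟩ := (aeval_apply_eq_zero_iff hf).1 hp
    rw [mul_comm, aeval_mul_apply, aeval_X_pow_apply, hy, map_zero]
  obtain ⟨g, hg⟩ := LinearMap.exists_extend
    (((LinearMap.ker (T x)).liftQ (T y) hker).comp (T x).quotKerEquivRange.symm.toLinearMap)
  have hg' : ∀ p : K[X], g (aeval f p x) = aeval f p y := by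
    intro p
    have h := LinearMap.congr_fun hg ((T x).quotKerEquivRange (Submodule.Quotient.mk p))
    simpa [hT] using h
  refine ⟨g.comp P, ?_, by simpa [hPx] using hg' 1, fun w hw => by simp [hw]⟩
  refine LinearMap.ext fun w => ?_
  obtain ⟨p, hp⟩ := mem_cyclic_iff.1 (hPc w)
  have h₁ : P (f w) = aeval f (X * p) x := by
    rw [aeval_mul_apply, aeval_X, ← hp]; exact LinearMap.congr_fun hP.eq w
  simp only [Module.End.mul_apply, LinearMap.comp_apply]
  rw [h₁, hp, hg', hg', aeval_mul_apply, aeval_X]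

lemma exists_commute_projection {A B : Submodule K V} (hA : ∀ x ∈ A, f x ∈ A)
    (hB : ∀ x ∈ B, f x ∈ B) (hAB : IsCompl A B) :
    ∃ P : Module.End K V, Commute P f ∧ (∀ x ∈ A, P x = x) ∧ (∀ x ∈ B, P x = 0) ∧
      (∀ x, P x ∈ A) ∧ ∀ x, x - P x ∈ B := by
  have h₁ : ∀ x ∈ A, A.projection B hAB x = x := fun x hx => by simpa using hx
  have h₂ : ∀ x ∈ B, A.projection B hAB x = 0 := fun x hx => by simpa using hx
  have hdec : ∀ x, ∃ a ∈ A, ∃ b ∈ B, a + b = x := fun x =>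
    Submodule.mem_sup.1 (hAB.sup_eq_top ▸ Submodule.mem_top)
  refine ⟨A.projection B hAB, ?_, h₁, h₂, Submodule.projection_apply_mem hAB,
    Submodule.sub_projection_mem hAB⟩
  · refine LinearMap.ext fun x => ?_
    obtain ⟨a, ha, b, hb, rfl⟩ := hdec x
    simp only [Module.End.mul_apply, map_add, h₁ _ ha, h₁ _ (hA _ ha), h₂ _ hb, h₂ _ (hB _ hb),
      map_zero]

end Cyclic

/-! ### Ulm quotients and the rigidity of unrepeated elementary divisors. -/

section Unrepeated

variable {f : Module.End K V}

/-- The vectors of exponent at most `r` that do not contribute to the multiplicity of the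
elementary divisor `X ^ r`. -/
def ulmKernel (f : Module.End K V) (r : ℕ) : Submodule K V :=
  LinearMap.ker (f ^ (r - 1)) ⊔ (LinearMap.ker (f ^ (r + 1))).map f

lemma map_mem_ulmKernel {g : Module.End K V} (hg : Commute g f) {r : ℕ} {x : V}
    (hx : x ∈ ulmKernel f r) : g x ∈ ulmKernel f r := by
  obtain ⟨a, ha, _, ⟨b, hb, rfl⟩, rfl⟩ := Submodule.mem_sup.1 hx
  have hpow : ∀ n y, (f ^ n) y = 0 → (f ^ n) (g y) = 0 := fun n y hy => by
    rw [← aeval_X_pow_apply, ← commute_aeval hg, aeval_X_pow_apply, hy, map_zero]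
  refine Submodule.mem_sup.2 ⟨g a, hpow _ _ ha, f (g b), ⟨g b, hpow _ _ hb, rfl⟩, ?_⟩
  rw [map_add]
  congr 1
  exact (LinearMap.congr_fun hg.eq b).symm

/-- A cyclic summand other than K[X]/(X^r) contributes nothing to the Ulm quotient: it is killed too
early (k < r), its r-torsion is divisible by X (k > r), or X acts invertibly on it (p ≠ X). -/
lemma exists_decomp_of_ne {p g : K[X]} {k r : ℕ} (hp : p.Monic) (hirr : Irreducible p)
    (hne : p ^ k ≠ X ^ r) (h : p ^ k ∣ X ^ r * g) :
    ∃ a b : K[X], g = a + X * b ∧ p ^ k ∣ X ^ (r - 1) * a ∧ p ^ k ∣ X ^ (r + 1) * b := by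
  by_cases hpX : p = X
  · subst hpX
    have hkr : k ≠ r := fun h => hne (by rw [h])
    rcases lt_or_gt_of_ne hkr with hlt | hlt
    · exact ⟨g, 0, by simp, (pow_dvd_pow X (by omega)).mul_right g, by simp⟩
    · obtain ⟨n, rfl⟩ := Nat.exists_eq_add_of_lt hlt
      rw [add_assoc, pow_add, mul_dvd_mul_iff_left (pow_ne_zero _ X_ne_zero)] at h
      obtain ⟨b, rfl⟩ := h
      exact ⟨0, X ^ n * b, by ring, by simp, ⟨b, by ring⟩⟩
  · have hcop : IsCoprime p X := hirr.coprime_iff_not_dvd.2 fun hd => hpX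
      (eq_of_monic_of_associated hp monic_X (hirr.associated_of_dvd irreducible_X hd))
    exact ⟨g, 0, by simp, ((hcop.pow (m := k) (n := r)).dvd_of_dvd_mul_left h).mul_left _, by simp⟩

/-- The Ulm quotient at an unrepeated divisor is spanned by the class of the generator of the one
summand K[X]/(X^r). -/
lemma exists_smul_sub_mem_ulmKernel {r : ℕ} (h : IsUnrepeated f r) :
    ∃ e : V, ∀ x, (f ^ r) x = 0 → ∃ c : K, x - c • e ∈ ulmKernel f r := by
  obtain ⟨m, d, ⟨hd, ⟨Φ⟩⟩, i₀, hi₀, huniq⟩ := h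
  -- Positivity makes the truncated r - 1 a genuine predecessor.
  have hr : 0 < r := by
    obtain ⟨p, k, -, hirr, hk, hpk⟩ := hd i₀
    rcases Nat.eq_zero_or_pos r with rfl | hr
    · rw [hi₀, pow_zero] at hpk
      exact absurd (IsUnit.of_pow_eq_one hpk.symm hk.ne') hirr.not_isUnit
    · exact hr
  let τ (y : (i : Fin m) → K[X] ⧸ Ideal.span {d i}) : V := (Module.AEval'.of f).symm (Φ.symm y)
  have hτ_add : ∀ y z, τ (y + z) = τ y + τ z := fun y z => by simp [τ]
  have hτ_C : ∀ (c : K) y, τ ((C c : K[X]) • y) = c • τ y := fun c y => by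
    simp [τ]
  have hτ_X : ∀ y, τ ((X : K[X]) • y) = f (τ y) := fun y => by
    simp only [τ, map_smul]
    exact Module.AEval'.of_symm_X_smul f (Φ.symm y)
  have hτ_pow : ∀ n y, τ ((X ^ n : K[X]) • y) = (f ^ n) (τ y) := fun n y => by
    induction n with
    | zero => simp
    | succ n ih => rw [pow_succ', mul_smul, hτ_X, ih, pow_succ', Module.End.mul_apply]
  have hτ_zero : τ 0 = 0 := by simp [τ]
  let π (g : Fin m → K[X]) : (i : Fin m) → K[X] ⧸ Ideal.span {d i} :=
    fun i => Ideal.Quotient.mk _ (g i)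
  have hπ_smul : ∀ (p : K[X]) g, p • π g = π fun i => p * g i := fun p g => rfl
  have hπ_zero : ∀ g, (∀ i, d i ∣ g i) → π g = 0 := fun g hg =>
    funext fun i => Ideal.Quotient.eq_zero_iff_dvd _ _ |>.2 (hg i)
  refine ⟨τ (π (Pi.single i₀ 1)), fun x hx => ?_⟩
  obtain ⟨y, rfl⟩ : ∃ y, x = τ y := ⟨Φ (Module.AEval'.of f x), by simp [τ]⟩
  choose g hg using fun i => Ideal.Quotient.mk_surjective (y i)
  obtain rfl : π g = y := funext hg
  have hXr : ∀ i, d i ∣ X ^ r * g i := by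
    have h0 : π (fun i => X ^ r * g i) = 0 := by
      rw [← hπ_smul]
      apply Φ.symm.injective
      apply (Module.AEval'.of f).symm.injective
      have := (hτ_pow r (π g)).trans hx
      simpa [τ] using this
    exact fun i => (Ideal.Quotient.eq_zero_iff_dvd _ _).1 (congrFun h0 i)
  have key : ∀ i, ∃ a b : K[X],
      g i = C ((g i₀).coeff 0) * (Pi.single i₀ 1 : Fin m → K[X]) i + (a + X * b) ∧
        d i ∣ X ^ (r - 1) * a ∧ d i ∣ X ^ (r + 1) * b := by
    intro i
    rcases eq_or_ne i i₀ with rfl | hi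
    -- On the distinguished summand only the constant term survives: the rest is a multiple of X,
    -- killed by X^(r-1).
    · obtain ⟨q, hq⟩ := exists_eq_C_add_X_mul (g i)
      refine ⟨X * q, 0, by simpa using hq, ⟨q, ?_⟩, by simp⟩
      rw [hi₀, ← mul_assoc, ← pow_succ, Nat.sub_add_cancel hr]
    · obtain ⟨p, k, hp, hirr, -, hpk⟩ := hd i
      have hne : p ^ k ≠ X ^ r := fun h => hi (huniq i (hpk.trans h))
      have := exists_decomp_of_ne hp hirr hne (hpk ▸ hXr i)
      simpa [hi, hpk] using this
  choose a b hab ha hb using key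
  refine ⟨(g i₀).coeff 0, Submodule.mem_sup.2
    ⟨τ (π a), ?_, f (τ (π b)), ⟨τ (π b), ?_, rfl⟩, ?_⟩⟩
  · rw [LinearMap.mem_ker, ← hτ_pow, hπ_smul, hπ_zero _ ha, hτ_zero]
  · rw [SetLike.mem_coe, LinearMap.mem_ker, ← hτ_pow, hπ_smul, hπ_zero _ hb, hτ_zero]
  · rw [eq_sub_iff_add_eq, ← hτ_X, ← hτ_C, ← hτ_add, ← hτ_add, add_comm]
    congr 1
    funext i
    conv_rhs => rw [show π g i = Ideal.Quotient.mk _ (g i) from rfl, hab i]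
    simp only [map_add]
    rfl

lemma eq_zero_or_one_of_card (hK : Nat.card K = 2) (c : K) : c = 0 ∨ c = 1 := by
  obtain ⟨y, -, hy⟩ := (Nat.card_eq_two_iff' (0 : K)).1 hK
  by_contra! h
  exact h.2 ((hy c h.1).trans (hy 1 one_ne_zero).symm)

/-- In a cyclic space of exponent exactly r, the kernel of f^(r-1) is already contained in the image
of f. -/
lemma exists_projection_eq_of_mem_ulmKernel (hf : IsNilpotent f) {u : V} {P : Module.End K V}
    (hP : Commute P f) (hPc : ∀ x, P x ∈ cyclic f u) (hu : 0 < exponent f u) {x : V}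
    (hx : x ∈ ulmKernel f (exponent f u)) : ∃ q : K[X], P x = aeval f (X * q) u := by
  obtain ⟨a, ha, _, ⟨b, hb, rfl⟩, rfl⟩ := Submodule.mem_sup.1 hx
  obtain ⟨p, hp⟩ := mem_cyclic_iff.1 (hPc a)
  obtain ⟨q, hq⟩ := mem_cyclic_iff.1 (hPc b)
  have h0 : aeval f (X ^ (exponent f u - 1) * p) u = 0 := by
    rw [aeval_mul_apply, ← hp, ← commute_aeval hP, aeval_X_pow_apply, LinearMap.mem_ker.1 ha,
      map_zero]
  rw [aeval_apply_eq_zero_iff hf] at h0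
  obtain ⟨n, hn⟩ := Nat.exists_eq_succ_of_ne_zero hu.ne'
  rw [hn, Nat.succ_eq_add_one, Nat.add_sub_cancel, pow_succ,
    mul_dvd_mul_iff_left (pow_ne_zero _ X_ne_zero)] at h0
  obtain ⟨p', rfl⟩ := h0
  refine ⟨p' + q, ?_⟩
  have hPf : P (f b) = f (P b) := LinearMap.congr_fun hP.eq b
  rw [map_add, hp, hPf, hq, mul_add, map_add, LinearMap.add_apply, aeval_mul_apply X q, aeval_X]

lemma symm_mem_Aut {α : V ≃ₗ[K] V} (hα : α ∈ Aut f) : α.symm ∈ Aut f := fun x => by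
  rw [LinearEquiv.symm_apply_eq, hα, LinearEquiv.apply_symm_apply]

lemma commute_of_mem_Aut {α : V ≃ₗ[K] V} (hα : α ∈ Aut f) :
    Commute (α : Module.End K V) f := LinearMap.ext hα

/-- Over the field with two elements, a commuting automorphism fixes a generator that belongs to an
unrepeated elementary divisor modulo the image of `f`. -/
lemma exists_projection_aut_eq (hK : Nat.card K = 2) (hf : IsNilpotent f) {u : V}
    (hunr : IsUnrepeated f (exponent f u)) {P : Module.End K V} (hP : Commute P f) (hPu : P u = u)
    (hPc : ∀ x, P x ∈ cyclic f u) (hu : 0 < exponent f u) {α : V ≃ₗ[K] V} (hα : α ∈ Aut f) :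
    ∃ q : K[X], P (α u) = u + aeval f (X * q) u := by
  have huN : u ∉ ulmKernel f (exponent f u) := by
    intro h
    obtain ⟨q, hq⟩ := exists_projection_eq_of_mem_ulmKernel hf hP hPc hu h
    have := le_of_smul_pow_apply_eq hf (x := u) (k := 0) (c := (1 : K)) (r := q) one_ne_zero
      (by simpa [hPu] using hq)
    omega
  obtain ⟨e, he⟩ := exists_smul_sub_mem_ulmKernel hunr
  -- With only the scalars 0 and 1, all vectors of ker f^r outside the Ulm kernel are congruent to
  -- each other, in particular u and α u.
  have hmem : ∀ x, (f ^ exponent f u) x = 0 → x ∉ ulmKernel f (exponent f u) →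
      x - e ∈ ulmKernel f (exponent f u) := by
    intro x hx hxN
    obtain ⟨c, hc⟩ := he x hx
    rcases eq_zero_or_one_of_card hK c with rfl | rfl
    · exact absurd (by simpa using hc) hxN
    · simpa using hc
  have hαN : α u ∉ ulmKernel f (exponent f u) := fun h => huN <| by
    simpa using map_mem_ulmKernel (commute_of_mem_Aut (symm_mem_Aut hα)) h
  have hαu : (f ^ exponent f u) (α u) = 0 := by
    have := commute_aeval (commute_of_mem_Aut hα) (X ^ exponent f u) u
    rw [aeval_X_pow_apply, aeval_X_pow_apply, pow_exponent_apply hf, map_zero] at this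
    exact this.symm
  have hsub := Submodule.sub_mem _ (hmem _ hαu hαN) (hmem _ (pow_exponent_apply hf u) huN)
  rw [sub_sub_sub_cancel_right] at hsub
  obtain ⟨q, hq⟩ := exists_projection_eq_of_mem_ulmKernel hf hP hPc hu hsub
  exact ⟨q, by rw [← hq, map_sub, hPu]; abel⟩

end Unrepeated

/-! ### Characteristic hulls, and part (i). -/

section CharHull

variable {f : Module.End K V}

lemma generated_le {B : Set V} {Y : Submodule K V} (hY : ∀ x ∈ Y, f x ∈ Y) (hB : B ⊆ Y) :
    generated f B ≤ Y :=
  iSup₂_le fun _ hb => cyclic_le hY (hB hb)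

lemma subset_generated (B : Set V) : B ⊆ generated f B := fun b hb =>
  (le_iSup₂ (f := fun b (_ : b ∈ B) => cyclic f b) b hb) (self_mem_cyclic b)

lemma map_mem_generated (B : Set V) : ∀ x ∈ generated f B, f x ∈ generated f B := by
  have : generated f B ≤ (generated f B).comap f := iSup₂_le fun b hb x hx =>
    (le_iSup₂ (f := fun b (_ : b ∈ B) => cyclic f b) b hb) (map_mem_cyclic b x hx)
  exact fun x hx => this hx

lemma isCharacteristic_charHull (B : Set V) : IsCharacteristic f (charHull f B) := by
  refine ⟨map_mem_generated _, fun α hα => ?_⟩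
  have : charHull f B ≤ (charHull f B).comap (α : Module.End K V) := by
    refine generated_le (fun x hx => ?_) ?_
    · have : α (f x) ∈ charHull f B := by rw [hα x]; exact map_mem_generated _ _ hx
      exact this
    · rintro _ ⟨b, hb, β, hβ, rfl⟩
      exact subset_generated _ ⟨b, hb, β.trans α, fun x => by simp [hβ x, hα (β x)], rfl⟩
  exact fun x hx => this hx

lemma subset_charHull (B : Set V) : B ⊆ charHull f B := fun b hb =>
  subset_generated _ ⟨b, hb, LinearEquiv.refl K V, fun _ => rfl, rfl⟩

lemma charHull_cyclic_le {z : V} {Y : Submodule K V} (hY : ∀ x ∈ Y, f x ∈ Y)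
    (hz : ∀ α ∈ Aut f, α z ∈ Y) : charHull f (cyclic f z) ≤ Y := by
  refine generated_le hY ?_
  rintro _ ⟨b, hb, α, hα, rfl⟩
  obtain ⟨p, rfl⟩ := mem_cyclic_iff.1 hb
  have := commute_aeval (commute_of_mem_Aut hα) p z
  rw [SetLike.mem_coe, show α (aeval f p z) = aeval f p (α z) from this]
  exact aeval_mem hY p (hz α hα)

lemma IsGenerator.exists_projection {u : V} (hu : IsGenerator f u) :
    ∃ P : Module.End K V, Commute P f ∧ P u = u ∧ ∀ x, P x ∈ cyclic f u := by
  obtain ⟨-, V₂, hV₂, hc⟩ := hu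
  obtain ⟨P, hP, hP₁, -, hP₂, -⟩ := exists_commute_projection (map_mem_cyclic u) hV₂ hc
  exact ⟨P, hP, hP₁ u (self_mem_cyclic u), hP₂⟩

/-- The vectors whose components along `u` and `v` have leading terms `c • f ^ a u` and
`c • f ^ b v` with a common coefficient `c`. -/
def linkedLeading (f P Q : Module.End K V) (a b : ℕ) (u v : V) : Submodule K V where
  carrier := {x | ∃ (c : K) (p q : K[X]), P x = c • (f ^ a) u + aeval f (X ^ (a + 1) * p) u ∧
    Q x = c • (f ^ b) v + aeval f (X ^ (b + 1) * q) v}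
  zero_mem' := ⟨0, 0, 0, by simp, by simp⟩
  add_mem' := by
    rintro x y ⟨c, p, q, hp, hq⟩ ⟨c', p', q', hp', hq'⟩
    refine ⟨c + c', p + p', q + q', ?_, ?_⟩
    · rw [map_add, hp, hp', mul_add, map_add, add_smul, LinearMap.add_apply]; abel
    · rw [map_add, hq, hq', mul_add, map_add, add_smul, LinearMap.add_apply]; abel
  smul_mem' := by
    rintro k x ⟨c, p, q, hp, hq⟩
    refine ⟨k * c, k • p, k • q, ?_, ?_⟩
    · rw [map_smul, hp, mul_smul_comm, map_smul, smul_add, mul_smul, LinearMap.smul_apply]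
    · rw [map_smul, hq, mul_smul_comm, map_smul, smul_add, mul_smul, LinearMap.smul_apply]

/-- Applying f moves both leading terms into the tails, so the common coefficient becomes 0. -/
lemma map_mem_linkedLeading {P Q : Module.End K V} (hP : Commute P f) (hQ : Commute Q f) {a b : ℕ}
    {u v : V} : ∀ x ∈ linkedLeading f P Q a b u v, f x ∈ linkedLeading f P Q a b u v := by
  have step : ∀ (n : ℕ) (c : K) (p : K[X]) (w : V),
      f (c • (f ^ n) w + aeval f (X ^ (n + 1) * p) w) =
        (0 : K) • (f ^ n) w + aeval f (X ^ (n + 1) * (C c + X * p)) w := by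
    intro n c p w
    have : (X ^ (n + 1) * (C c + X * p) : K[X]) = X * (c • X ^ n + X ^ (n + 1) * p) := by
      rw [smul_eq_C_mul]; ring
    rw [this, aeval_mul_apply X, aeval_X]
    simp
  rintro x ⟨c, p, q, hp, hq⟩
  refine ⟨0, C c + X * p, C c + X * q, ?_, ?_⟩
  · rw [show P (f x) = f (P x) from LinearMap.congr_fun hP.eq x, hp, step]
  · rw [show Q (f x) = f (Q x) from LinearMap.congr_fun hQ.eq x, hq, step]

lemma exists_eq_aeval_of_pow_apply_eq_zero (hf : IsNilpotent f) {v w : V} (hw : w ∈ cyclic f v)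
    {n : ℕ} (hn : n ≤ exponent f v) (h : (f ^ n) w = 0) :
    ∃ q : K[X], w = aeval f (X ^ (exponent f v - n) * q) v := by
  obtain ⟨p, rfl⟩ := mem_cyclic_iff.1 hw
  rw [← aeval_X_pow_apply, ← aeval_mul_apply, aeval_apply_eq_zero_iff hf] at h
  obtain ⟨k, hk⟩ := Nat.exists_eq_add_of_le hn
  rw [hk, pow_add, mul_dvd_mul_iff_left (pow_ne_zero _ X_ne_zero)] at h
  obtain ⟨q, rfl⟩ := h
  exact ⟨q, by rw [hk, Nat.add_sub_cancel_left]⟩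

/-- The projections P and Q come from separate decompositions, so P v and Q u need not vanish; the
inequalities control them. -/
theorem not_isHyperinvariant_charHull (hK : Nat.card K = 2) (hf : IsNilpotent f) {u v : V}
    (hu : IsGenerator f u) (hv : IsGenerator f v) (hunru : IsUnrepeated f (exponent f u))
    (hunrv : IsUnrepeated f (exponent f v)) {a b : ℕ} (hau : a < exponent f u) (hab : a < b)
    (hbv : b + exponent f u < a + exponent f v) :
    ¬ IsHyperinvariant f (charHull f (cyclic f ((f ^ a) u + (f ^ b) v))) := by
  intro hhyp
  obtain ⟨P, hP, hPu, hPc⟩ := hu.exists_projection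
  obtain ⟨Q, hQ, hQv, hQc⟩ := hv.exists_projection
  set z := (f ^ a) u + (f ^ b) v with hz
  have pow_comm : ∀ {g : Module.End K V}, Commute g f → ∀ n x, g ((f ^ n) x) = (f ^ n) (g x) :=
    fun hg n x => by simpa only [aeval_X_pow_apply] using commute_aeval hg (X ^ n) x
  -- Q (g u) is killed by f^R, so it lies in f^(S-R)⟨v⟩; applying f^a gives order a + S - R > b.
  have hQu : ∀ g : Module.End K V, Commute g f →
      ∃ q : K[X], Q ((f ^ a) (g u)) = aeval f (X ^ (b + 1) * q) v := by
    intro g hg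
    obtain ⟨q, hq⟩ := exists_eq_aeval_of_pow_apply_eq_zero hf (hQc (g u)) (n := exponent f u)
      (by omega) (by rw [← pow_comm hQ, ← pow_comm hg, pow_exponent_apply hf]; simp)
    obtain ⟨k, hk⟩ := Nat.exists_eq_add_of_lt hbv
    refine ⟨X ^ k * q, ?_⟩
    rw [pow_comm hQ, hq, ← aeval_X_pow_apply, ← aeval_mul_apply, ← mul_assoc, ← mul_assoc, ← pow_add,
      ← pow_add]
    congr 4
    omega
  have hle : charHull f (cyclic f z) ≤ linkedLeading f P Q a b u v := by
    refine charHull_cyclic_le (map_mem_linkedLeading hP hQ) fun α hα => ?_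
    have hαf := commute_of_mem_Aut hα
    have hαz : α z = (f ^ a) (α u) + (f ^ b) (α v) := by
      rw [hz, map_add]
      exact congrArg₂ _ (pow_comm hαf a u) (pow_comm hαf b v)
    obtain ⟨p₁, hp₁⟩ := exists_projection_aut_eq hK hf hunru hP hPu hPc (by omega) hα
    obtain ⟨q₁, hq₁⟩ := exists_projection_aut_eq hK hf hunrv hQ hQv hQc (by omega) hα
    obtain ⟨p₂, hp₂⟩ := mem_cyclic_iff.1 (hPc (α v))
    obtain ⟨q₂, hq₂⟩ := hQu α hαf
    obtain ⟨k, rfl⟩ := Nat.exists_eq_add_of_lt hab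
    refine ⟨1, p₁ + X ^ k * p₂, q₁ + q₂, ?_, ?_⟩
    · rw [hαz, map_add, pow_comm hP, pow_comm hP, hp₁, hp₂, map_add,
        ← aeval_X_pow_apply a (aeval f _ _), ← aeval_X_pow_apply (a + k + 1), ← aeval_mul_apply,
        ← aeval_mul_apply, one_smul, add_assoc, ← LinearMap.add_apply, ← map_add]
      congr 3
      ring
    · have hq₂' : Q ((f ^ a) (α u)) = _ := hq₂
      rw [hαz, map_add, hq₂', pow_comm hQ, hq₁, map_add, ← aeval_X_pow_apply _ (aeval f _ _),
        ← aeval_mul_apply, one_smul, add_left_comm, ← LinearMap.add_apply, ← map_add]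
      congr 3
      ring
  have hzmem : z ∈ charHull f (cyclic f z) := subset_charHull _ (self_mem_cyclic z)
  obtain ⟨p, hp⟩ := mem_cyclic_iff.1 (hPc v)
  obtain ⟨k, hk⟩ := Nat.exists_eq_add_of_lt hab
  -- Since a < b, the contribution of v changes f^a u only by a unit of `K[f]`, so hyperinvariance
  -- would put f^a u itself into the hull.
  have hPz : P z = aeval f (1 + X ^ (k + 1) * p) ((f ^ a) u) := by
    rw [hz, map_add, pow_comm hP, pow_comm hP, hPu, hp, ← aeval_X_pow_apply, ← aeval_X_pow_apply,
      ← aeval_mul_apply, ← aeval_mul_apply, ← LinearMap.add_apply, ← map_add, hk]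
    congr 2
    ring
  obtain ⟨r, hr⟩ := exists_aeval_inv hf (q := 1 + X ^ (k + 1) * p) (by simp [mul_coeff_zero])
  have hmem : (f ^ a) u ∈ charHull f (cyclic f z) := by
    rw [← hr ((f ^ a) u), ← hPz]
    exact aeval_mem (hhyp f (Commute.refl f)) r (hhyp P hP z hzmem)
  obtain ⟨c, p', q', hp', hq'⟩ := hle hmem
  obtain ⟨q, hq⟩ := hQu 1 (Commute.one_left f)
  -- Q (f^a u) has order beyond b < S, so the common coefficient is 0; the P-component f^a u would
  -- then be a tail, against a < R.
  have hc : c = 0 := by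
    by_contra hc
    have := le_of_smul_pow_apply_eq hf (x := v) (k := b) (r := q - q') hc (by
      rw [mul_sub, map_sub, LinearMap.sub_apply, ← hq, eq_sub_iff_add_eq, ← hq']; rfl)
    omega
  rw [pow_comm hP, hPu, hc, zero_smul, zero_add] at hp'
  have := le_of_smul_pow_apply_eq hf (c := (1 : K)) one_ne_zero (by rwa [one_smul])
  omega

end CharHull

/-! ### The two-summand case, and the converse in part (ii). -/

section Converse

variable {f : Module.End K V}

/-- 1 + E is a commuting automorphism, and E x = (1 + E) x - x. -/
lemma IsCharacteristic.map_mem_of_isNilpotent {Y : Submodule K V} (hY : IsCharacteristic f Y)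
    {E : Module.End K V} (hE : Commute E f) (hn : IsNilpotent E) {x : V} (hx : x ∈ Y) :
    E x ∈ Y := by
  let α : V ≃ₗ[K] V :=
    LinearEquiv.ofBijective (1 + E) ((Module.End.isUnit_iff _).1 hn.isUnit_one_add)
  have hα : ∀ y, α y = y + E y := fun y => rfl
  have hmem : α ∈ Aut f := fun y => by
    rw [hα, hα, map_add, show E (f y) = f (E y) from LinearMap.congr_fun hE.eq y]
  have := Y.sub_mem (hY.2 α hmem x hx) hx
  rwa [hα, add_sub_cancel_left] at this

lemma exists_eq_aeval_pow_apply (hf : IsNilpotent f) {Y : Submodule K V} (hY : ∀ x ∈ Y, f x ∈ Y)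
    {u w : V} (hw : w ∈ cyclic f u) (hfw : f w ∈ Y) (hw0 : w ≠ 0) :
    ∃ (a : ℕ) (q : K[X]), q.coeff 0 ≠ 0 ∧ (f ^ (a + 1)) u ∈ Y ∧ w = aeval f (X ^ a * q) u := by
  obtain ⟨p, rfl⟩ := mem_cyclic_iff.1 hw
  obtain ⟨a, q, rfl, hq⟩ := exists_eq_X_pow_mul (p := p) (by rintro rfl; simp at hw0)
  obtain ⟨r, hr⟩ := exists_aeval_inv hf hq
  refine ⟨a, q, hq, ?_, rfl⟩
  rw [← hr ((f ^ (a + 1)) u), ← aeval_X_pow_apply (a + 1), ← aeval_mul_apply q]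
  refine aeval_mem hY r ?_
  rwa [show q * X ^ (a + 1) = X * (X ^ a * q) by ring, aeval_mul_apply, aeval_X]

lemma exists_aeval_pow_mul_eq (a : ℕ) (q : K[X]) (u : V) :
    ∃ r : K[X], aeval f (X ^ a * q) u =
      q.coeff 0 • (f ^ a) u + aeval f r ((f ^ (a + 1)) u) := by
  obtain ⟨r, hr⟩ := exists_eq_C_add_X_mul q
  refine ⟨r, ?_⟩
  have : X ^ a * q = q.coeff 0 • X ^ a + r * X ^ (a + 1) := by
    conv_lhs => rw [hr]
    rw [smul_eq_C_mul]; ring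
  rw [this, map_add, LinearMap.add_apply, map_smul, LinearMap.smul_apply, aeval_X_pow_apply,
    aeval_mul_apply, aeval_X_pow_apply]

/-- If w had order below a, then f w ∈ Y would force f^a u ∈ Y after dividing by a unit. -/
lemma exists_eq_smul_pow_add (hf : IsNilpotent f) {Y : Submodule K V} (hY : ∀ x ∈ Y, f x ∈ Y)
    {u w : V} (hw : w ∈ cyclic f u) (hfw : f w ∈ Y) {a : ℕ} (ha : (f ^ a) u ∉ Y) :
    ∃ (k : K) (r : K[X]), w = k • (f ^ a) u + aeval f r ((f ^ (a + 1)) u) := by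
  rcases eq_or_ne w 0 with rfl | hw0
  · exact ⟨0, 0, by simp⟩
  obtain ⟨c, q, -, hc, rfl⟩ := exists_eq_aeval_pow_apply hf hY hw hfw hw0
  have hac : a ≤ c := by
    by_contra! h
    exact ha (pow_mem_of_le hY h hc)
  obtain ⟨n, rfl⟩ := Nat.exists_eq_add_of_le hac
  rw [pow_add, mul_assoc]
  exact ⟨_, exists_aeval_pow_mul_eq a (X ^ n * q) u⟩

lemma apply_eq_of_mem_cyclic {g g' : Module.End K V} (hg : Commute g f) (hg' : Commute g' f)
    {u w : V} {r : K[X]} (h : g u = aeval f r (g' u)) (hw : w ∈ cyclic f u) :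
    g w = aeval f r (g' w) := by
  obtain ⟨p, rfl⟩ := mem_cyclic_iff.1 hw
  rw [commute_aeval hg, h, commute_aeval hg', ← aeval_mul_apply, ← aeval_mul_apply, mul_comm]

lemma lt_exponent_of_pow_apply_notMem (hf : IsNilpotent f) {Y : Submodule K V}
    (hY : ∀ x ∈ Y, f x ∈ Y) {u : V} {a : ℕ} (ha : (f ^ a) u ∉ Y) : a < exponent f u := by
  by_contra! h
  exact ha (pow_mem_of_le hY h (by rw [pow_exponent_apply hf]; exact Y.zero_mem))

/-- Two complementary projections commuting with `f`, with cyclic images generated by `u` and `v`,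
and two square-zero maps exchanging these images. -/
structure BicyclicMaps (f : Module.End K V) (u v : V) (P Q E₁ E₂ : Module.End K V) : Prop where
  commP : Commute P f
  commQ : Commute Q f
  commE₁ : Commute E₁ f
  commE₂ : Commute E₂ f
  P_mem : ∀ x, P x ∈ cyclic f u
  Q_mem : ∀ x, Q x ∈ cyclic f v
  add_eq : ∀ x, P x + Q x = x
  P_u : P u = u
  P_v : P v = 0
  Q_u : Q u = 0
  Q_v : Q v = v
  E₁_u : E₁ u = (f ^ (exponent f v - exponent f u)) v
  E₁_v : E₁ v = 0
  E₂_u : E₂ u = 0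
  E₂_v : E₂ v = u

lemma exists_bicyclicMaps (hf : IsNilpotent f) {u v : V} (hle : exponent f u ≤ exponent f v)
    (hc : IsCompl (cyclic f u) (cyclic f v)) : ∃ P Q E₁ E₂, BicyclicMaps f u v P Q E₁ E₂ := by
  obtain ⟨P, hP, hP₁, hP₂, hP₃, hP₄⟩ :=
    exists_commute_projection (map_mem_cyclic u) (map_mem_cyclic v) hc
  have hu := self_mem_cyclic (f := f) u
  have hv := self_mem_cyclic (f := f) v
  have hQ : Commute (1 - P) f := (Commute.one_left f).sub_left hP
  have hQv : (1 - P) v = v := by simp [hP₂ v hv]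
  have hQu : (1 - P) u = 0 := by simp [hP₁ u hu]
  obtain ⟨E₁, hE₁, hE₁u, hE₁0⟩ := exists_commute_apply_eq hf hP (hP₁ u hu) hP₃
    (y := (f ^ (exponent f v - exponent f u)) v) (by
      rw [← Module.End.mul_apply, ← pow_add, Nat.add_sub_cancel' hle, pow_exponent_apply hf])
  obtain ⟨E₂, hE₂, hE₂v, hE₂0⟩ := exists_commute_apply_eq hf hQ hQv (y := u) hP₄ (by
    rw [← Nat.sub_add_cancel hle, pow_add, Module.End.mul_apply, pow_exponent_apply hf, map_zero])
  exact ⟨P, 1 - P, E₁, E₂, hP, hQ, hE₁, hE₂, hP₃, hP₄, fun x => by simp, hP₁ u hu, hP₂ v hv, hQu,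
    hQv, hE₁u, hE₁0 v (hP₂ v hv), hE₂0 u hQu, hE₂v⟩

namespace BicyclicMaps

variable {u v : V} {P Q E₁ E₂ : Module.End K V}

lemma apply_eq_zero_of_mem_cyclic {g : Module.End K V} (hg : Commute g f) (h : g u = 0) {w : V}
    (hw : w ∈ cyclic f u) : g w = 0 := by
  simpa using apply_eq_of_mem_cyclic (g' := 1) (r := 0) hg (Commute.one_left f) (by simpa using h) hw

lemma E₁_isNilpotent (h : BicyclicMaps f u v P Q E₁ E₂) : IsNilpotent E₁ := by
  refine ⟨2, LinearMap.ext fun x => ?_⟩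
  rw [pow_two, Module.End.mul_apply, ← h.add_eq x, map_add,
    apply_eq_zero_of_mem_cyclic h.commE₁ h.E₁_v (h.Q_mem x), add_zero]
  refine apply_eq_zero_of_mem_cyclic (h.commE₁.mul_left h.commE₁) ?_ (h.P_mem x)
  rw [Module.End.mul_apply, h.E₁_u, ← aeval_X_pow_apply, commute_aeval h.commE₁, h.E₁_v, map_zero]

lemma E₂_isNilpotent (h : BicyclicMaps f u v P Q E₁ E₂) : IsNilpotent E₂ := by
  refine ⟨2, LinearMap.ext fun x => ?_⟩
  rw [pow_two, Module.End.mul_apply, ← h.add_eq x, map_add,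
    apply_eq_zero_of_mem_cyclic h.commE₂ h.E₂_u (h.P_mem x), zero_add]
  refine apply_eq_zero_of_mem_cyclic (h.commE₂.mul_left h.commE₂) ?_ (h.Q_mem x)
  rw [Module.End.mul_apply, h.E₂_v, h.E₂_u]

/-- Each of the four blocks of a commuting g is a polynomial in f times P, E₂, E₁ or Q, and Y is
stable under all of these. -/
lemma isHyperinvariant (hf : IsNilpotent f) (h : BicyclicMaps f u v P Q E₁ E₂)
    (hle : exponent f u ≤ exponent f v) {Y : Submodule K V} (hY : IsCharacteristic f Y)
    (hPY : ∀ x ∈ Y, P x ∈ Y) : IsHyperinvariant f Y := by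
  intro g hg x hx
  have hPx := hPY x hx
  have hQx : Q x ∈ Y := by
    rw [eq_sub_of_add_eq' (h.add_eq x)]; exact Y.sub_mem hx hPx
  have aux : ∀ {w y : V} {T T' : Module.End K V}, w ∈ cyclic f y → Commute T f → Commute T' f →
      (∃ r : K[X], T (g y) = aeval f r (T' y)) → T' w ∈ Y → T (g w) ∈ Y := by
    rintro w y T T' hw hT hT' ⟨r, hr⟩ hwY
    have := apply_eq_of_mem_cyclic (hT.mul_left hg) hT' (r := r) hr hw
    rw [← Module.End.mul_apply, this]
    exact aeval_mem hY.1 r hwY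
  rw [← h.add_eq (g x), ← h.add_eq x]
  simp only [map_add]
  refine Y.add_mem (Y.add_mem ?_ ?_) (Y.add_mem ?_ ?_)
  · exact aux (h.P_mem x) h.commP (Commute.one_left f) (mem_cyclic_iff.1 (h.P_mem _)) hPx
  · refine aux (h.Q_mem x) h.commP h.commE₂ ?_
      (hY.map_mem_of_isNilpotent h.commE₂ h.E₂_isNilpotent hQx)
    rw [h.E₂_v]
    exact mem_cyclic_iff.1 (h.P_mem _)
  · refine aux (h.P_mem x) h.commQ h.commE₁ ?_
      (hY.map_mem_of_isNilpotent h.commE₁ h.E₁_isNilpotent hPx)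
    -- f^R kills the Q-component of g u, which is therefore a multiple of f^(S-R) v = E₁ u.
    obtain ⟨q, hq⟩ := exists_eq_aeval_of_pow_apply_eq_zero hf (h.Q_mem (g u)) hle (by
      rw [← aeval_X_pow_apply, ← commute_aeval h.commQ, ← commute_aeval hg, aeval_X_pow_apply,
        pow_exponent_apply hf, map_zero, map_zero])
    exact ⟨q, by rw [hq, h.E₁_u, mul_comm, aeval_mul_apply, aeval_X_pow_apply]⟩
  · exact aux (h.Q_mem x) h.commQ (Commute.one_left f) (mem_cyclic_iff.1 (h.Q_mem _)) hQx

/-- A characteristic subspace that is not hyperinvariant is the characteristic hull of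
`f ^ a u + f ^ b v` for suitable `a` and `b`. -/
theorem exists_eq_charHull (hK : Nat.card K = 2) (hf : IsNilpotent f)
    (h : BicyclicMaps f u v P Q E₁ E₂) (hle : exponent f u ≤ exponent f v) {Y : Submodule K V}
    (hY : IsCharacteristic f Y) (hYn : ¬ IsHyperinvariant f Y) :
    ∃ a b : ℕ, a < exponent f u ∧ b < exponent f v ∧ a < b ∧
      b + exponent f u < a + exponent f v ∧ Y = charHull f (cyclic f ((f ^ a) u + (f ^ b) v)) := by
  have hfP : ∀ {Z : Submodule K V}, IsCharacteristic f Z → ∀ x ∈ Z, f (P x) ∈ Z := fun hZ x hx =>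
    hZ.map_mem_of_isNilpotent ((Commute.refl f).mul_left h.commP)
      (h.commP.symm.isNilpotent_mul_right hf) hx
  have hfQ : ∀ {Z : Submodule K V}, IsCharacteristic f Z → ∀ x ∈ Z, f (Q x) ∈ Z := fun hZ x hx =>
    hZ.map_mem_of_isNilpotent ((Commute.refl f).mul_left h.commQ)
      (h.commQ.symm.isNilpotent_mul_right hf) hx
  have pow_comm : ∀ {g : Module.End K V}, Commute g f → ∀ n x, g ((f ^ n) x) = (f ^ n) (g x) :=
    fun hg n x => by simpa only [aeval_X_pow_apply] using commute_aeval hg (X ^ n) x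
  -- The leading coefficient is nonzero, hence 1, so modulo Y the vector w is exactly a power of f
  -- applied to y.
  have lead : ∀ {y w : V}, w ∈ cyclic f y → f w ∈ Y → w ∉ Y →
      ∃ a : ℕ, (f ^ a) y ∉ Y ∧ (f ^ (a + 1)) y ∈ Y ∧ w - (f ^ a) y ∈ Y := by
    intro y w hw hfw hwY
    obtain ⟨a, q, hq, ha, hwq⟩ :=
      exists_eq_aeval_pow_apply hf hY.1 hw hfw (by rintro rfl; exact hwY Y.zero_mem)
    obtain ⟨r, hr⟩ := exists_aeval_pow_mul_eq (f := f) a q y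
    rw [← hwq, (eq_zero_or_one_of_card hK _).resolve_left hq, one_smul] at hr
    have hwa : w - (f ^ a) y ∈ Y := by
      rw [hr, add_sub_cancel_left]; exact aeval_mem hY.1 r ha
    exact ⟨a, fun hmem => hwY (by simpa using Y.add_mem hwa hmem), ha, hwa⟩
  obtain ⟨x, hx, hPx⟩ : ∃ x ∈ Y, P x ∉ Y := by
    by_contra! hcon
    exact hYn (isHyperinvariant hf h hle hY hcon)
  have hQx : Q x ∉ Y := fun hmem => hPx <| by
    rw [eq_sub_of_add_eq (h.add_eq x)]; exact Y.sub_mem hx hmem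
  obtain ⟨a, ha, ha', hxa⟩ := lead (h.P_mem x) (hfP hY x hx) hPx
  obtain ⟨b, hb, hb', hxb⟩ := lead (h.Q_mem x) (hfQ hY x hx) hQx
  set z := (f ^ a) u + (f ^ b) v with hz
  have hzY : z ∈ Y := by
    have := Y.sub_mem hx (Y.add_mem hxa hxb)
    rwa [sub_add_sub_comm, h.add_eq, sub_sub_cancel] at this
  have hau := lt_exponent_of_pow_apply_notMem hf hY.1 ha
  have hbv := lt_exponent_of_pow_apply_notMem hf hY.1 hb
  refine ⟨a, b, hau, hbv, ?_, ?_, ?_⟩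
  -- E₂ z = f^b u lies in Y while f^a u does not, whence a < b; symmetrically, E₁ z yields the other
  -- inequality.
  · have := hY.map_mem_of_isNilpotent h.commE₂ h.E₂_isNilpotent hzY
    rw [hz, map_add, pow_comm h.commE₂, pow_comm h.commE₂, h.E₂_u, h.E₂_v, map_zero, zero_add]
      at this
    by_contra! hba
    exact ha (pow_mem_of_le hY.1 hba this)
  · have := hY.map_mem_of_isNilpotent h.commE₁ h.E₁_isNilpotent hzY
    rw [hz, map_add, pow_comm h.commE₁, pow_comm h.commE₁, h.E₁_u, h.E₁_v, map_zero, add_zero,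
      ← Module.End.mul_apply, ← pow_add] at this
    by_contra! hba
    exact hb (pow_mem_of_le hY.1 (by omega) this)
  · refine le_antisymm (fun y hy => ?_) ?_
    · set H := charHull f (cyclic f z)
      have hH : IsCharacteristic f H := isCharacteristic_charHull _
      have hzH : z ∈ H := subset_charHull _ (self_mem_cyclic z)
      have haH : (f ^ (a + 1)) u ∈ H := by
        have := hfP hH z hzH
        rwa [hz, map_add, pow_comm h.commP, pow_comm h.commP, h.P_u, h.P_v, map_zero, add_zero,
          ← Module.End.mul_apply, ← pow_succ'] at this
      have hbH : (f ^ (b + 1)) v ∈ H := by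
        have := hfQ hH z hzH
        rwa [hz, map_add, pow_comm h.commQ, pow_comm h.commQ, h.Q_u, h.Q_v, map_zero, zero_add,
          ← Module.End.mul_apply, ← pow_succ'] at this
      obtain ⟨k, r, hk⟩ := exists_eq_smul_pow_add hf hY.1 (h.P_mem y) (hfP hY y hy) ha
      obtain ⟨k', r', hk'⟩ := exists_eq_smul_pow_add hf hY.1 (h.Q_mem y) (hfQ hY y hy) hb
      have hrH := H.add_mem (aeval_mem hH.1 r haH) (aeval_mem hH.1 r' hbH)
      have hrY := Y.add_mem (aeval_mem hY.1 r ha') (aeval_mem hY.1 r' hb')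
      have hyz : y = k • z + (k' - k) • (f ^ b) v +
          (aeval f r ((f ^ (a + 1)) u) + aeval f r' ((f ^ (b + 1)) v)) := by
        rw [← h.add_eq y, hk, hk', hz, smul_add, sub_smul]; abel
      -- Unequal leading coefficients would put f^b v into Y.
      have hkk : k' - k = 0 := by
        by_contra hne
        have := Y.sub_mem (Y.sub_mem hy hrY) (Y.smul_mem k hzY)
        rw [hyz, add_sub_cancel_right, add_sub_cancel_left] at this
        exact hb ((Y.smul_mem_iff hne).1 this)
      rw [hyz, hkk, zero_smul, add_zero]
      exact H.add_mem (H.smul_mem k hzH) hrH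
    · refine charHull_cyclic_le hY.1 fun α hα => hY.2 α hα z hzY

end BicyclicMaps

end Converse

end CharSub

theorem mainTheorem1 {K V : Type*} [Field K] [AddCommGroup V] [Module K V]
    [FiniteDimensional K V] (hK : Nat.card K = 2)
    (f : Module.End K V) (hf : IsNilpotent f)
    (R S : ℕ) (hRS : R + 1 < S)
    (hR : CharSub.IsUnrepeated f R) (hS : CharSub.IsUnrepeated f S)
    (u v : V) (hu : CharSub.IsGenerator f u) (hv : CharSub.IsGenerator f v)
    (heu : CharSub.exponent f u = R) (hev : CharSub.exponent f v = S) :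
    (∀ s q : ℕ, 0 < s → s ≤ R → s < q → (R : ℤ) - s < (S : ℤ) - q →
      CharSub.IsCharacteristic f
          (CharSub.charHull f (CharSub.cyclic f ((f ^ (R - s)) u + (f ^ (S - q)) v))) ∧
        ¬ CharSub.IsHyperinvariant f
          (CharSub.charHull f (CharSub.cyclic f ((f ^ (R - s)) u + (f ^ (S - q)) v)))) ∧
    (IsCompl (CharSub.cyclic f u) (CharSub.cyclic f v) →
      ∀ X : Submodule K V, (∀ x ∈ X, f x ∈ X) →
        ((CharSub.IsCharacteristic f X ∧ ¬ CharSub.IsHyperinvariant f X) ↔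
          ∃ s q : ℕ, 0 < s ∧ s ≤ R ∧ s < q ∧ (R : ℤ) - s < (S : ℤ) - q ∧
            X = CharSub.charHull f
              (CharSub.cyclic f ((f ^ (R - s)) u + (f ^ (S - q)) v)))) := by
  subst heu hev
  have and_of_imp : ∀ {p q : Prop}, p → (p → q) → p ∧ q := fun hp h => ⟨hp, h hp⟩
  -- Part (i) is the "if" direction of (ii). Since 0 ≤ R - s < S - q, neither natural subtraction
  -- truncates.
  refine and_of_imp (fun s q hs hsR hsq hlt => ⟨CharSub.isCharacteristic_charHull _,
    CharSub.not_isHyperinvariant_charHull hK hf hu hv hR hS (by omega) (by omega) (by omega)⟩)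
    fun hull hc Y _ => ⟨?_, ?_⟩
  · rintro ⟨hY, hYn⟩
    obtain ⟨P, Q, E₁, E₂, h⟩ := CharSub.exists_bicyclicMaps hf (by omega) hc
    obtain ⟨a, b, hau, hbv, hab, hba, hYeq⟩ := h.exists_eq_charHull hK hf (by omega) hY hYn
    refine ⟨CharSub.exponent f u - a, CharSub.exponent f v - b, by omega, by omega, by omega,
      by omega, ?_⟩
    rw [hYeq, Nat.sub_sub_self hau.le, Nat.sub_sub_self hbv.le]
  · rintro ⟨s, q, hs, hsR, hsq, hlt, rfl⟩
    exact hull s q hs hsR hsq hlt
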